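/- **Theorem 3.12.** Let $\mathcal A'$, $\mathcal A$, $\mathcal A''$ be abelian categories, each with enough projective and enough injective objects, and let $$(\mathcal A',\mathcal A,\mathcal A'',i^*,i_*,i^!,j_!,j^*,j_*)$$ be a recollement; that is, $i_*:\mathcal A'\to\mathcal A$, $i^*,i^!:\mathcal A\to\mathcal A'$, $j^*:\mathcal A\to\mathcal A''$ and $j_!,j_*:\mathcal A''\to\mathcal A$ are functors such that $(i^*,i_*)$, $(i_*,i^!)$, $(j_!,j^*)$, $(j^*,j_*)$ are adjoint pairs, $i_*$, $j_!$, $j_*$ are fully faithful, and the objects $X$ of $\mathcal A$ with $j^*X=0$ are exactly those isomorphic to $i_*Y$ for some $Y\in\mathcal A'$. Assume that the recollement satisfies condition (P): for every projective object $P$ of $\mathcal A$ the counit $\varepsilon_P:j_!j^*P\to P$ of the adjoint pair $(j_!,j^*)$ is a monomorphism. For a class $\mathcal C$ of objects in an abelian category put $\mathcal C^\perp=\{X\mid \operatorname{Ext}^1(C,X)=0 \text{ for all } C\in\mathcal C\}$ and ${}^\perp\mathcal C=\{X\mid \operatorname{Ext}^1(X,C)=0 \text{ for all } C\in\mathcal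 C\}$. A pair $(\mathcal C,\mathcal D)$ of classes of objects is a *cotorsion pair* if $\mathcal C^\perp=\mathcal D$ and ${}^\perp\mathcal D=\mathcal C$. It is *complete* if for every object $M$ there are short exact sequences $0\to D_1\to C_1\to M\to 0$ and $0\to M\to D_2\to C_2\to 0$ with $C_1,C_2\in\mathcal C$ and $D_1,D_2\in\mathcal D$. It is *hereditary* if $\mathcal C$ is closed under kernels of epimorphisms (between objects of $\mathcal C$) and $\mathcal D$ is closed under cokernels of monomorphisms (between objects of $\mathcal D$). Let $(\mathcal U',\mathcal V')$ and $(\mathcal U'',\mathcal V'')$ be complete hereditary cotorsion pairs in $\mathcal A'$ and $\mathcal A''$, respectively. Assume that the first left derived functor of $j_!$ satisfies $(\mathbb L_1 j_!)(U)=0$ for all $U\in\mathcal U''$ and that the first right derived functor of $j_*$ satisfies $(\mathbb R_1 j_*)(V)=0$ for all $V\in\mathcal V''$. Put $$\mathcal M^{\mathcal U'}_{\mathcal U''}=\{X\in\mathcal A\mid i^*X\in\mathcal U',\ j^*X\in\mathcal U'',\ (\mathbb L_1 i^*)(X)=0\},$$ $$\mathcal N^{\mathcal V'}_{\mathcal V''}=\{X\in\mathcal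 A\mid i^!X\in\mathcal V',\ j^*X\in\mathcal V'',\ (\mathbb R_1 i^!)(X)=0\}.$$ Then $(\mathcal M^{\mathcal U'}_{\mathcal U''},\mathcal N^{\mathcal V'}_{\mathcal V''})$ is a complete hereditary cotorsion pair in $\mathcal A$. -/

import Mathlib

open CategoryTheory CategoryTheory.Limits

universe v₁ v₂ v₃ u₁ u₂ u₃ v u

namespace RecollementGluing

section CotorsionPairs

variable {C : Type u} [Category.{v} C] [Abelian C]

/-- `Ext¹(X, Y) = 0`. Mathlib's `Ext` is formed in the universe in which it always exists
(`HasExt.standard`), so that no smallness assumption is needed. -/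
def Ext1Vanishes (X Y : C) : Prop :=
  letI : HasExt.{max u v} C := HasExt.standard C
  Subsingleton (Abelian.Ext.{max u v} X Y 1)

/-- The class `𝒰^⊥` of all `Y` with `Ext¹(X, Y) = 0` for all `X ∈ 𝒰`. -/
def rightPerp (U : ObjectProperty C) : ObjectProperty C :=
  fun Y => ∀ X : C, U X → Ext1Vanishes X Y

/-- The class `^⊥𝒱` of all `X` with `Ext¹(X, Y) = 0` for all `Y ∈ 𝒱`. -/
def leftPerp (V : ObjectProperty C) : ObjectProperty C :=
  fun X => ∀ Y : C, V Y → Ext1Vanishes X Y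

/-- `(𝒰, 𝒱)` is a cotorsion pair: `𝒰^⊥ = 𝒱` and `^⊥𝒱 = 𝒰`. -/
structure IsCotorsionPair (U V : ObjectProperty C) : Prop where
  rightPerp_eq : rightPerp U = V
  leftPerp_eq : leftPerp V = U

/-- A cotorsion pair `(𝒰, 𝒱)` is complete if every object `M` fits into short exact sequences
`0 ⟶ V₁ ⟶ U₁ ⟶ M ⟶ 0` and `0 ⟶ M ⟶ V₂ ⟶ U₂ ⟶ 0` with `Uᵢ ∈ 𝒰` and `Vᵢ ∈ 𝒱`. It is hereditary
if `𝒰` is closed under kernels of epimorphisms and `𝒱` is closed under cokernels of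
monomorphisms. -/
structure IsCompleteHereditaryCotorsionPair (U V : ObjectProperty C) : Prop
    extends IsCotorsionPair U V where
  exists_left : ∀ M : C, ∃ (V₁ U₁ : C) (f : V₁ ⟶ U₁) (g : U₁ ⟶ M) (w : f ≫ g = 0),
    (ShortComplex.mk f g w).ShortExact ∧ U U₁ ∧ V V₁
  exists_right : ∀ M : C, ∃ (V₂ U₂ : C) (f : M ⟶ V₂) (g : V₂ ⟶ U₂) (w : f ≫ g = 0),
    (ShortComplex.mk f g w).ShortExact ∧ U U₂ ∧ V V₂
  kernel_mem : ∀ S : ShortComplex C, S.ShortExact → U S.X₂ → U S.X₃ → U S.X₁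
  cokernel_mem : ∀ S : ShortComplex C, S.ShortExact → V S.X₁ → V S.X₂ → V S.X₃

end CotorsionPairs

/-- A recollement of the abelian category `A` relative to the abelian categories `A'` and `A''`.
The six functors are `iPull = i^*`, `iPush = i_*`, `iShriek = i^!`, `jShriek = j_!`,
`jPull = j^*` and `jPush = j_*`. -/
structure Recollement (A' : Type u₁) [Category.{v₁} A'] [Abelian A']
    (A : Type u₂) [Category.{v₂} A] [Abelian A]
    (A'' : Type u₃) [Category.{v₃} A''] [Abelian A''] where
  iPull : A ⥤ A'
  iPush : A' ⥤ A
  iShriek : A ⥤ A'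
  jShriek : A'' ⥤ A
  jPull : A ⥤ A''
  jPush : A'' ⥤ A
  /-- `i^* ⊣ i_*` -/
  iAdj : iPull ⊣ iPush
  /-- `i_* ⊣ i^!` -/
  iAdj' : iPush ⊣ iShriek
  /-- `j_! ⊣ j^*` -/
  jAdj : jShriek ⊣ jPull
  /-- `j^* ⊣ j_*` -/
  jAdj' : jPull ⊣ jPush
  iPush_full : iPush.Full
  iPush_faithful : iPush.Faithful
  jShriek_full : jShriek.Full
  jShriek_faithful : jShriek.Faithful
  jPush_full : jPush.Full
  jPush_faithful : jPush.Faithful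
  /-- `Ker j^* = Im i_*`, the image being closed under isomorphisms. -/
  kernel_eq : jPull.kernel = iPush.essImage

/-- A functor between abelian categories that has a left adjoint is additive. -/
theorem additive_of_rightAdjoint {A : Type u₁} [Category.{v₁} A] [Abelian A]
    {B : Type u₂} [Category.{v₂} B] [Abelian B] {F : A ⥤ B} {G : B ⥤ A} (adj : F ⊣ G) :
    G.Additive := by
  have : PreservesLimitsOfSize.{0, 0} G := adj.rightAdjoint_preservesLimits
  exact Functor.additive_of_preserves_binary_products G

namespace Recollement

variable {A' : Type u₁} [Category.{v₁} A'] [Abelian A']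
  {A : Type u₂} [Category.{v₂} A] [Abelian A]
  {A'' : Type u₃} [Category.{v₃} A''] [Abelian A'']
  (r : Recollement A' A A'')

instance : r.iPush.Additive := additive_of_rightAdjoint r.iAdj
instance : r.iShriek.Additive := additive_of_rightAdjoint r.iAdj'
instance : r.jPull.Additive := additive_of_rightAdjoint r.jAdj
instance : r.jPush.Additive := additive_of_rightAdjoint r.jAdj'
instance : r.iPull.Additive := r.iAdj.left_adjoint_additive
instance : r.jShriek.Additive := r.jAdj.left_adjoint_additive

/-- Condition (P): the counit `j_! j^* P ⟶ P` is a monomorphism for every projective `P`. -/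
def ConditionP : Prop :=
  ∀ P : A, Projective P → Mono (r.jAdj.counit.app P)

/-- The class `ℳ^𝒳_𝒴` of all `X` with `i^* X ∈ 𝒳`, `j^* X ∈ 𝒴` and `(L₁ i^*)(X) = 0`. -/
def classM [EnoughProjectives A] (P : ObjectProperty A') (Q : ObjectProperty A'') :
    ObjectProperty A :=
  fun X => P (r.iPull.obj X) ∧ Q (r.jPull.obj X) ∧ IsZero ((r.iPull.leftDerived 1).obj X)

/-- The class `𝒩^𝒳_𝒴` of all `X` with `i^! X ∈ 𝒳`, `j^* X ∈ 𝒴` and `(R₁ i^!)(X) = 0`. -/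
def classN [EnoughInjectives A] (P : ObjectProperty A') (Q : ObjectProperty A'') :
    ObjectProperty A :=
  fun X => P (r.iShriek.obj X) ∧ Q (r.jPull.obj X) ∧ IsZero ((r.iShriek.rightDerived 1).obj X)

end Recollement

end RecollementGluing

/-! Under condition (P), `L₁ i^*` vanishes at `X` exactly when the counit `j_! j^* X ⟶ X` is mono
(`isZero_leftDerived_iPull_iff`). Hence every `X` in `ℳ` is an extension of `i_* i^* X` by `j_! j^*
X`. By adjunction, `Ext¹(j_! Z, Y)` vanishes as soon as `Ext¹(Z, j^* Y)` does, and `Ext¹(i_* Z, Y)`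
as soon as `Ext¹(Z, i^! Y)` and `(R₁ i^!)(Y)` do. This gives `Ext¹(ℳ, 𝒩) = 0`.

The rest follows from `isCompleteHereditaryCotorsionPair_of_exists_left`, given closure properties
and an epimorphism from an object of `ℳ` onto each object, with kernel in `𝒩`. Vanishing of `L₁ j_!`
on `𝒰''` puts the injectives into `𝒩` and makes `ℳ` closed under kernels of epimorphisms. Vanishing
of `R₁ j_*` on `𝒱''` puts `j_* 𝒱''` into `𝒩`.

The approximation (`exists_left_approximation`) is a composite of three epimorphisms. The first has
kernel in `j_* 𝒱''` and brings `j^*` into `𝒰''`. The other two have kernels in `i_* 𝒱'`, so they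
leave `j^*` unchanged: one makes the counit mono, the other brings `i^*` into `𝒰'`. -/

namespace RecollementGluing

/-! ### Base change, cobase change and kernels in short exact sequences. -/

section ShortExactSequences

variable {C : Type u} [Category.{v} C] [Abelian C]

/-- The base change of a short exact sequence. -/
theorem shortExact_of_isPullback {S : ShortComplex C} (hS : S.ShortExact) {E D : C}
    {p : E ⟶ S.X₂} {q : E ⟶ D} {h : D ⟶ S.X₃} (sq : IsPullback p q S.g h) :
    (ShortComplex.mk (sq.lift S.f 0 (by simp)) q (by simp)).ShortExact := by
  have := hS.mono_f
  have := hS.epi_g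
  have hm : Mono (sq.lift S.f 0 (by simp)) :=
    mono_of_mono_fac (h := S.f) (sq.lift_fst _ _ _)
  have he : Epi q := (MorphismProperty.epimorphisms C).of_isPullback sq this
  refine .mk' ?_ hm he
  rw [ShortComplex.exact_iff_exact_up_to_refinements]
  intro T x hx
  dsimp at x hx
  obtain ⟨T', π, hπ, y, hy⟩ := hS.exact.exact_up_to_refinements (x ≫ p)
    (by rw [Category.assoc, sq.w, reassoc_of% hx, zero_comp])
  exact ⟨T', π, hπ, y, sq.hom_ext (by simpa using hy) (by simp [hx])⟩

/-- The cobase change of a short exact sequence. -/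
theorem shortExact_of_isPushout {S : ShortComplex C} (hS : S.ShortExact) {E D : C}
    {i : S.X₁ ⟶ D} {p : S.X₂ ⟶ E} {q : D ⟶ E} (sq : IsPushout S.f i p q) :
    (ShortComplex.mk q (sq.desc S.g 0 (by simp)) (by simp)).ShortExact := by
  have := hS.mono_f
  have := hS.epi_g
  have he : Epi (sq.desc S.g 0 (by simp)) :=
    epi_of_epi_fac (h := S.g) (sq.inl_desc _ _ _)
  have hm : Mono q := (MorphismProperty.monomorphisms C).of_isPushout sq.flip ‹Mono S.f›
  refine .mk' ?_ hm he
  rw [ShortComplex.exact_iff_exact_up_to_refinements]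
  intro T x hx
  dsimp at x hx
  obtain ⟨T₁, π₁, hπ₁, y, z, hyz⟩ := sq.hom_eq_add_up_to_refinements x
  have hy : y ≫ S.g = 0 := by
    have := hyz =≫ sq.desc S.g 0 (by simp)
    simpa [hx] using this.symm
  obtain ⟨T₂, π₂, hπ₂, k, hk⟩ := hS.exact.exact_up_to_refinements y hy
  refine ⟨T₂, π₂ ≫ π₁, epi_comp _ _, k ≫ i + π₂ ≫ z, ?_⟩
  simp [hyz, reassoc_of% hk, sq.w]

/-- A morphism of short exact sequences that is an identity on the third objects is a pushout
on the first two. -/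
theorem isPushout_of_shortExact {S : ShortComplex C} (hS : S.ShortExact) {K Y : C}
    {f : K ⟶ Y} {g : Y ⟶ S.X₃} {w : f ≫ g = 0} (hT : (ShortComplex.mk f g w).ShortExact)
    {a : S.X₁ ⟶ K} {b : S.X₂ ⟶ Y} (h₁ : S.f ≫ b = a ≫ f) (h₂ : b ≫ g = S.g) :
    IsPushout S.f a b f := by
  have sq := IsPushout.of_hasPushout S.f a
  let φ : ShortComplex.mk (pushout.inr S.f a) (sq.desc S.g 0 (by simp)) (by simp) ⟶
      ShortComplex.mk f g w :=
    { τ₁ := 𝟙 _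
      τ₂ := sq.desc b f h₁
      τ₃ := 𝟙 _
      comm₂₃ := sq.hom_ext (by simp [h₂]) (by simp [w]) }
  have : IsIso φ.τ₂ := ShortComplex.isIso₂_of_shortExact_of_isIso₁₃ φ
    (shortExact_of_isPushout hS sq) hT
  exact sq.of_iso (Iso.refl _) (Iso.refl _) (Iso.refl _) (asIso φ.τ₂) (by simp) (by simp)
    (by simp [φ]) (by simp [φ])

/-- A morphism of short exact sequences that is an identity on the first objects is a pullback
on the last two. -/
theorem isPullback_of_shortExact {S : ShortComplex C} (hS : S.ShortExact) {Y K : C}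
    {f : S.X₁ ⟶ Y} {g : Y ⟶ K} {w : f ≫ g = 0} (hT : (ShortComplex.mk f g w).ShortExact)
    {b : Y ⟶ S.X₂} {a : K ⟶ S.X₃} (h₁ : b ≫ S.g = g ≫ a) (h₂ : f ≫ b = S.f) :
    IsPullback b g S.g a := by
  have sq := IsPullback.of_hasPullback S.g a
  let φ : ShortComplex.mk f g w ⟶
      ShortComplex.mk (sq.lift S.f 0 (by simp)) (pullback.snd S.g a) (by simp) :=
    { τ₁ := 𝟙 _
      τ₂ := sq.lift b g h₁
      τ₃ := 𝟙 _
      comm₁₂ := sq.hom_ext (by simp [h₂]) (by simp [w]) }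
  have : IsIso φ.τ₂ := ShortComplex.isIso₂_of_shortExact_of_isIso₁₃ φ
    hT (shortExact_of_isPullback hS sq)
  exact sq.of_iso (asIso φ.τ₂).symm (Iso.refl _) (Iso.refl _) (Iso.refl _)
    (by simp [φ]) (by simp [φ]) (by simp) (by simp)

theorem shortExact_kernel {X Y : C} (g : X ⟶ Y) [Epi g] :
    (ShortComplex.mk (kernel.ι g) g (by simp)).ShortExact :=
  .mk' (ShortComplex.exact_kernel g) inferInstance ‹_›

theorem shortExact_cokernel {X Y : C} (f : X ⟶ Y) [Mono f] :
    (ShortComplex.mk f (cokernel.π f) (by simp)).ShortExact :=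
  .mk' (ShortComplex.exact_cokernel f) ‹_› inferInstance

theorem shortExact_biprod_of_isPushout {X₁ X₂ X₃ X₄ : C} {k : X₁ ⟶ X₂} {a : X₁ ⟶ X₃}
    {p : X₂ ⟶ X₄} {q : X₃ ⟶ X₄} (sq : IsPushout k a p q) [Mono k] :
    (ShortComplex.mk (biprod.lift k (-a)) (biprod.desc p q) (by simp [sq.w])).ShortExact :=
  .mk' sq.exact_shortComplex (mono_of_mono_fac (biprod.lift_fst k (-a))) sq.epi_shortComplex_g

/-- The kernels of two epimorphisms and of their composition form a short exact sequence. -/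
theorem shortExact_kernel_comp {X Y Z : C} (f : X ⟶ Y) (g : Y ⟶ Z) [Epi f] :
    (ShortComplex.mk (kernel.lift (f ≫ g) (kernel.ι f) (by simp))
      (kernel.lift g (kernel.ι (f ≫ g) ≫ f) (by simp))
      (by simp [← cancel_mono (kernel.ι g)])).ShortExact := by
  -- The kernel of `f ≫ g` is the base change of `kernel g` along `f`.
  have sq : IsPullback (kernel.ι (f ≫ g)) (kernel.lift g (kernel.ι (f ≫ g) ≫ f) (by simp)) f
      (kernel.ι g) := by
    refine ⟨⟨by simp⟩, ⟨PullbackCone.IsLimit.mk _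
      (fun s => kernel.lift _ s.fst (by rw [s.condition_assoc]; simp)) ?_ ?_ ?_⟩⟩
    · intro s; simp
    · intro s; simp [← cancel_mono (kernel.ι g), s.condition]
    · intro s m h _; simp [← cancel_mono (kernel.ι (f ≫ g)), h]
  have := shortExact_of_isPullback (shortExact_kernel f) sq
  convert this using 2
  simp [← cancel_mono (kernel.ι (f ≫ g))]

end ShortExactSequences

/-! ### Vanishing of `Ext¹` through lifting, extension and splitting. -/

section Ext

variable {C : Type u} [Category.{v} C] [Abelian C]

open Abelian

theorem Ext1Vanishes.exists_lift {S : ShortComplex C} (hS : S.ShortExact) {X : C}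
    (h : Ext1Vanishes X S.X₁) (x : X ⟶ S.X₃) : ∃ y : X ⟶ S.X₂, y ≫ S.g = x := by
  let : HasExt.{max u v} C := HasExt.standard C
  have : Subsingleton (Abelian.Ext.{max u v} X S.X₁ 1) := h
  obtain ⟨y, hy⟩ := Ext.covariant_sequence_exact₃ X hS (Ext.mk₀ x) (zero_add 1)
    (Subsingleton.elim _ _)
  obtain ⟨y, rfl⟩ := Ext.homEquiv₀.symm.surjective y
  exact ⟨y, (Ext.mk₀_bijective _ _).1 (by simpa using hy)⟩

theorem Ext1Vanishes.exists_extension {S : ShortComplex C} (hS : S.ShortExact) {Y : C}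
    (h : Ext1Vanishes S.X₃ Y) (x : S.X₁ ⟶ Y) : ∃ y : S.X₂ ⟶ Y, S.f ≫ y = x := by
  let : HasExt.{max u v} C := HasExt.standard C
  have : Subsingleton (Abelian.Ext.{max u v} S.X₃ Y 1) := h
  obtain ⟨y, hy⟩ := Ext.contravariant_sequence_exact₁ hS Y (Ext.mk₀ x) (add_zero 1)
    (Subsingleton.elim _ _)
  obtain ⟨y, rfl⟩ := Ext.homEquiv₀.symm.surjective y
  exact ⟨y, (Ext.mk₀_bijective _ _).1 (by simpa using hy)⟩

theorem ext1Vanishes_of_projective (X Y : C) [Projective X] : Ext1Vanishes X Y := by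
  let : HasExt.{max u v} C := HasExt.standard C
  exact Ext.subsingleton_of_projective X Y 0

theorem ext1Vanishes_of_injective (X Y : C) [Injective Y] : Ext1Vanishes X Y := by
  let : HasExt.{max u v} C := HasExt.standard C
  exact Ext.subsingleton_of_injective X Y 0

/-- `Ext¹(X, Y)` vanishes as soon as it does so on the outer terms of a short exact sequence with
middle term `Y`. -/
theorem ext1Vanishes_middle_right {S : ShortComplex C} (hS : S.ShortExact) {X : C}
    (h₁ : Ext1Vanishes X S.X₁) (h₃ : Ext1Vanishes X S.X₃) : Ext1Vanishes X S.X₂ := by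
  let : HasExt.{max u v} C := HasExt.standard C
  have : Subsingleton (Abelian.Ext.{max u v} X S.X₁ 1) := h₁
  have : Subsingleton (Abelian.Ext.{max u v} X S.X₃ 1) := h₃
  refine subsingleton_of_forall_eq 0 fun x => ?_
  obtain ⟨y, rfl⟩ := Ext.covariant_sequence_exact₂ X hS x (Subsingleton.elim _ _)
  rw [Subsingleton.elim y 0, Ext.zero_comp]

theorem ext1Vanishes_middle_left {S : ShortComplex C} (hS : S.ShortExact) {Y : C}
    (h₁ : Ext1Vanishes S.X₁ Y) (h₃ : Ext1Vanishes S.X₃ Y) : Ext1Vanishes S.X₂ Y := by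
  let : HasExt.{max u v} C := HasExt.standard C
  have : Subsingleton (Abelian.Ext.{max u v} S.X₁ Y 1) := h₁
  have : Subsingleton (Abelian.Ext.{max u v} S.X₃ Y 1) := h₃
  refine subsingleton_of_forall_eq 0 fun x => ?_
  obtain ⟨y, rfl⟩ := Ext.contravariant_sequence_exact₂ hS Y x (Subsingleton.elim _ _)
  rw [Subsingleton.elim y 0, Ext.comp_zero]

theorem Ext1Vanishes.of_retract_left {X X' Y : C} (r : Retract X X') (h : Ext1Vanishes X' Y) :
    Ext1Vanishes X Y := by
  let : HasExt.{max u v} C := HasExt.standard C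
  have : Subsingleton (Abelian.Ext.{max u v} X' Y 1) := h
  refine subsingleton_of_forall_eq 0 fun x => ?_
  rw [← Ext.mk₀_id_comp x, ← r.retract, ← Ext.mk₀_comp_mk₀_assoc,
    Subsingleton.elim ((Ext.mk₀ r.r).comp x (zero_add 1)) 0, Ext.comp_zero]

theorem Ext1Vanishes.of_retract_right {X Y Y' : C} (r : Retract Y Y') (h : Ext1Vanishes X Y') :
    Ext1Vanishes X Y := by
  let : HasExt.{max u v} C := HasExt.standard C
  have : Subsingleton (Abelian.Ext.{max u v} X Y' 1) := h
  refine subsingleton_of_forall_eq 0 fun x => ?_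
  rw [← Ext.comp_mk₀_id x, ← r.retract, ← Ext.mk₀_comp_mk₀,
    ← Ext.comp_assoc_of_third_deg_zero,
    Subsingleton.elim (x.comp (Ext.mk₀ r.i) (add_zero 1)) 0, Ext.zero_comp]

/-- `Ext¹(X, Y)` vanishes if the morphisms to `Y` extend along the kernel of an epimorphism from a
projective object to `X`. -/
theorem ext1Vanishes_of_exists_extension {S : ShortComplex C} (hS : S.ShortExact)
    [Projective S.X₂] {Y : C} (h : ∀ x : S.X₁ ⟶ Y, ∃ y : S.X₂ ⟶ Y, S.f ≫ y = x) :
    Ext1Vanishes S.X₃ Y := by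
  let : HasExt.{max u v} C := HasExt.standard C
  have : Subsingleton (Abelian.Ext.{max u v} S.X₂ Y 1) := Ext.subsingleton_of_projective _ _ 0
  refine subsingleton_of_forall_eq 0 fun x => ?_
  obtain ⟨y, rfl⟩ := Ext.contravariant_sequence_exact₃ hS Y x (Subsingleton.elim _ _) (add_zero 1)
  obtain ⟨y, rfl⟩ := Ext.homEquiv₀.symm.surjective y
  obtain ⟨z, rfl⟩ := h y
  rw [Ext.homEquiv₀_symm_apply, ← Ext.mk₀_comp_mk₀]
  exact hS.extClass_comp_assoc _

/-- `Ext¹(X, Y)` vanishes if every extension of `X` by `Y` splits. -/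
theorem ext1Vanishes_of_forall_split [EnoughProjectives C] {X Y : C}
    (h : ∀ (E : C) (f : Y ⟶ E) (g : E ⟶ X) (w : f ≫ g = 0),
      (ShortComplex.mk f g w).ShortExact → ∃ s : X ⟶ E, s ≫ g = 𝟙 X) :
    Ext1Vanishes X Y := by
  refine ext1Vanishes_of_exists_extension (shortExact_kernel (Projective.π X)) fun x => ?_
  -- A retraction of the pushout of the projective presentation along `x` restricts to an extension
  -- of `x`.
  have sq := IsPushout.of_hasPushout (kernel.ι (Projective.π X)) x
  have hT := shortExact_of_isPushout (shortExact_kernel (Projective.π X)) sq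
  obtain ⟨s, hs⟩ := h _ _ _ _ hT
  have := hT.mono_f
  let σ := ShortComplex.Splitting.ofExactOfSection _ hT.exact s hs hT.mono_f
  refine ⟨pushout.inl _ _ ≫ σ.r, ?_⟩
  have := σ.f_r
  dsimp at this ⊢
  rw [sq.w_assoc, this, Category.comp_id]

end Ext

/-! ### First derived functors tested on a single short exact sequence. -/

section DerivedFunctors

variable {C : Type u₁} [Category.{v₁} C] [Abelian C] {D : Type u₂} [Category.{v₂} D] [Abelian D]

/-- Preservation of monomorphy under a right exact functor passes from the kernel of an epimorphism
`P ⟶ X` with `P` projective to all short exact sequences ending in `X`. -/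
theorem mono_map_of_mono_map_of_projective (F : C ⥤ D) [PreservesFiniteColimits F]
    {S : ShortComplex C} (hS : S.ShortExact) [Projective S.X₂] (hF : Mono (F.map S.f))
    {K Y : C} {f : K ⟶ Y} {g : Y ⟶ S.X₃} {w : f ≫ g = 0}
    (hT : (ShortComplex.mk f g w).ShortExact) : Mono (F.map f) := by
  have : Epi g := hT.epi_g
  have : Mono f := hT.mono_f
  -- Lifting `S.X₂ ⟶ S.X₃` to `Y` exhibits the second sequence as a cobase change of the first; `F`
  -- preserves this pushout.
  have h : (S.f ≫ Projective.factorThru S.g g) ≫ g = 0 := by simp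
  have sq := isPushout_of_shortExact hS hT (a := hT.exact.lift _ h)
    (b := Projective.factorThru S.g g) (hT.exact.lift_f _ h).symm (by simp)
  exact (MorphismProperty.monomorphisms D).of_isPushout (sq.map F).flip hF

theorem epi_map_of_epi_map_of_injective (G : C ⥤ D) [PreservesFiniteLimits G]
    {S : ShortComplex C} (hS : S.ShortExact) [Injective S.X₂] (hG : Epi (G.map S.g))
    {Y K : C} {f : S.X₁ ⟶ Y} {g : Y ⟶ K} {w : f ≫ g = 0}
    (hT : (ShortComplex.mk f g w).ShortExact) : Epi (G.map g) := by
  have : Epi g := hT.epi_g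
  have : Mono f := hT.mono_f
  have h : f ≫ Injective.factorThru S.f f ≫ S.g = 0 := by simp
  have sq := isPullback_of_shortExact hS hT (a := hT.exact.desc _ h)
    (b := Injective.factorThru S.f f) (hT.exact.g_desc _ h).symm (by simp)
  exact (MorphismProperty.epimorphisms D).of_isPullback (sq.map G) hG

theorem exact_comp_iff_mono {S : ShortComplex C} (hS : S.Exact) [Epi S.g] {Z : C} (k : S.X₃ ⟶ Z) :
    (ShortComplex.mk S.f (S.g ≫ k) (by simp)).Exact ↔ Mono k := by
  constructor
  · intro h
    refine Preadditive.mono_of_cancel_zero _ fun {T} x hx => ?_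
    obtain ⟨T₁, π₁, _, y, hy⟩ := surjective_up_to_refinements_of_epi S.g x
    obtain ⟨T₂, π₂, _, z, hz⟩ := h.exact_up_to_refinements y
      (by dsimp; rw [← reassoc_of% hy, hx, comp_zero])
    dsimp at z hz
    rw [← cancel_epi π₁, ← cancel_epi π₂, hy, reassoc_of% hz, S.zero]
    simp
  · intro _
    let φ : S ⟶ ShortComplex.mk S.f (S.g ≫ k) (by simp) := { τ₁ := 𝟙 _, τ₂ := 𝟙 _, τ₃ := k }
    exact (ShortComplex.exact_iff_of_epi_of_isIso_of_mono φ).1 hS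

theorem exact_comp_iff_epi {S : ShortComplex C} (hS : S.Exact) [Mono S.f] {Z : C} (k : Z ⟶ S.X₁) :
    (ShortComplex.mk (k ≫ S.f) S.g (by simp)).Exact ↔ Epi k := by
  constructor
  · intro h
    rw [epi_iff_surjective_up_to_refinements]
    intro T x
    obtain ⟨T₁, π₁, hπ₁, y, hy⟩ := h.exact_up_to_refinements (x ≫ S.f) (by simp)
    exact ⟨T₁, π₁, hπ₁, y, by simpa [← cancel_mono S.f] using hy⟩
  · intro _
    let φ : ShortComplex.mk (k ≫ S.f) S.g (by simp) ⟶ S := { τ₁ := k, τ₂ := 𝟙 _, τ₃ := 𝟙 _ }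
    exact (ShortComplex.exact_iff_of_epi_of_isIso_of_mono φ).2 hS

/-- In a projective resolution let `K` be the kernel of `P₀ ⟶ X`. Right exactness makes `F P₂ ⟶ F P₁
⟶ F K ⟶ 0` exact, so the homology at `F P₁` measures the failure of `F K ⟶ F P₀` to be mono. -/
theorem exists_isZero_leftDerived_one_iff [EnoughProjectives C] (F : C ⥤ D) [F.Additive]
    [PreservesFiniteColimits F] (X : C) :
    ∃ (K P : C) (f : K ⟶ P) (g : P ⟶ X) (w : f ≫ g = 0), (ShortComplex.mk f g w).ShortExact ∧
      Projective P ∧ (IsZero ((F.leftDerived 1).obj X) ↔ Mono (F.map f)) := by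
  let P := projectiveResolution X
  let g : P.complex.X 0 ⟶ X := P.π.f 0
  have hg : P.complex.d 1 0 ≫ g = 0 := P.complex_d_comp_π_f_zero
  have : Epi g := inferInstanceAs (Epi (P.π.f 0))
  have h₀ : (ShortComplex.mk _ _ hg).Exact :=
    ShortComplex.exact_of_g_is_cokernel _ P.isColimitCokernelCofork
  let π : P.complex.X 1 ⟶ kernel g := kernel.lift g (P.complex.d 1 0) hg
  have : Epi π := ShortComplex.exact_iff_epi_kernel_lift _ |>.1 h₀
  have hπ : π ≫ kernel.ι g = P.complex.d 1 0 := kernel.lift_ι _ _ _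
  have w : P.complex.d 2 1 ≫ π = 0 := by simp [← cancel_mono (kernel.ι g), hπ]
  have h₁ : (ShortComplex.mk _ _ w).Exact := by
    let φ : ShortComplex.mk _ _ w ⟶ ShortComplex.mk _ _ (P.complex.d_comp_d 2 1 0) :=
      { τ₁ := 𝟙 _, τ₂ := 𝟙 _, τ₃ := kernel.ι g }
    exact (ShortComplex.exact_iff_of_epi_of_isIso_of_mono φ).2 (P.exact_succ 0)
  refine ⟨_, _, _, _, _, shortExact_kernel g, inferInstance, ?_⟩
  have h₂ : ((ShortComplex.mk _ _ w).map F).Exact :=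
    h₁.map_of_epi_of_preservesCokernel F ‹_› inferInstance
  have : Epi ((ShortComplex.mk _ _ w).map F).g := inferInstanceAs (Epi (F.map π))
  refine Iff.trans ?_ (exact_comp_iff_mono h₂ (F.map (kernel.ι g)))
  refine ((P.isoLeftDerivedObj F 1).isZero_iff).trans ?_
  refine (HomologicalComplex.exactAt_iff_isZero_homology _ _).symm.trans ?_
  rw [HomologicalComplex.exactAt_iff' _ 2 1 0 (by simp) (by simp)]
  refine ShortComplex.exact_iff_of_iso
    (ShortComplex.isoMk (Iso.refl _) (Iso.refl _) (Iso.refl _) ?_ ?_)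
  · exact (Category.id_comp _).trans (Category.comp_id _).symm
  · exact (Category.id_comp _).trans
      (((F.map_comp _ _).symm.trans (congrArg F.map hπ)).trans (Category.comp_id _).symm)

theorem exists_isZero_rightDerived_one_iff [EnoughInjectives C] (G : C ⥤ D) [G.Additive]
    [PreservesFiniteLimits G] (X : C) :
    ∃ (I K : C) (f : X ⟶ I) (g : I ⟶ K) (w : f ≫ g = 0), (ShortComplex.mk f g w).ShortExact ∧
      Injective I ∧ (IsZero ((G.rightDerived 1).obj X) ↔ Epi (G.map g)) := by
  let I := injectiveResolution X
  let f : X ⟶ I.cocomplex.X 0 := I.ι.f 0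
  have hf : f ≫ I.cocomplex.d 0 1 = 0 := I.ι_f_zero_comp_complex_d
  have : Mono f := inferInstanceAs (Mono (I.ι.f 0))
  have h₀ : (ShortComplex.mk _ _ hf).Exact :=
    ShortComplex.exact_of_f_is_kernel _ I.isLimitKernelFork
  let π : cokernel f ⟶ I.cocomplex.X 1 := cokernel.desc f (I.cocomplex.d 0 1) hf
  have : Mono π := ShortComplex.exact_iff_mono_cokernel_desc _ |>.1 h₀
  have hπ : cokernel.π f ≫ π = I.cocomplex.d 0 1 := cokernel.π_desc _ _ _
  have w : π ≫ I.cocomplex.d 1 2 = 0 := by simp [← cancel_epi (cokernel.π f), reassoc_of% hπ]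
  have h₁ : (ShortComplex.mk _ _ w).Exact := by
    let φ : ShortComplex.mk _ _ (I.cocomplex.d_comp_d 0 1 2) ⟶ ShortComplex.mk _ _ w :=
      { τ₁ := cokernel.π f, τ₂ := 𝟙 _, τ₃ := 𝟙 _ }
    exact (ShortComplex.exact_iff_of_epi_of_isIso_of_mono φ).1 (I.exact_succ 0)
  refine ⟨_, _, _, _, _, shortExact_cokernel f, inferInstance, ?_⟩
  have h₂ : ((ShortComplex.mk _ _ w).map G).Exact :=
    h₁.map_of_mono_of_preservesKernel G ‹_› inferInstance
  have : Mono ((ShortComplex.mk _ _ w).map G).f := inferInstanceAs (Mono (G.map π))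
  refine Iff.trans ?_ (exact_comp_iff_epi h₂ (G.map (cokernel.π f)))
  refine ((I.isoRightDerivedObj G 1).isZero_iff).trans ?_
  refine (HomologicalComplex.exactAt_iff_isZero_homology _ _).symm.trans ?_
  rw [HomologicalComplex.exactAt_iff' _ 0 1 2 (by simp) (by simp)]
  refine ShortComplex.exact_iff_of_iso
    (ShortComplex.isoMk (Iso.refl _) (Iso.refl _) (Iso.refl _) ?_ ?_)
  · exact (Category.id_comp _).trans
      (((G.map_comp _ _).symm.trans (congrArg G.map hπ)).trans (Category.comp_id _).symm)
  · exact (Category.id_comp _).trans (Category.comp_id _).symm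

theorem mono_map_of_isZero_leftDerived_one [EnoughProjectives C] (F : C ⥤ D) [F.Additive]
    [PreservesFiniteColimits F] {S : ShortComplex C} (hS : S.ShortExact)
    (h : IsZero ((F.leftDerived 1).obj S.X₃)) : Mono (F.map S.f) := by
  obtain ⟨K, P, f, g, w, hT, _, hiff⟩ := exists_isZero_leftDerived_one_iff F S.X₃
  exact mono_map_of_mono_map_of_projective F hT (hiff.1 h) hS

theorem isZero_leftDerived_one_of_mono_map [EnoughProjectives C] (F : C ⥤ D) [F.Additive]
    [PreservesFiniteColimits F] {S : ShortComplex C} (hS : S.ShortExact) [Projective S.X₂]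
    (h : Mono (F.map S.f)) : IsZero ((F.leftDerived 1).obj S.X₃) := by
  obtain ⟨K, P, f, g, w, hT, _, hiff⟩ := exists_isZero_leftDerived_one_iff F S.X₃
  exact hiff.2 (mono_map_of_mono_map_of_projective F hS h hT)

theorem epi_map_of_isZero_rightDerived_one [EnoughInjectives C] (G : C ⥤ D) [G.Additive]
    [PreservesFiniteLimits G] {S : ShortComplex C} (hS : S.ShortExact)
    (h : IsZero ((G.rightDerived 1).obj S.X₁)) : Epi (G.map S.g) := by
  obtain ⟨I, K, f, g, w, hT, _, hiff⟩ := exists_isZero_rightDerived_one_iff G S.X₁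
  exact epi_map_of_epi_map_of_injective G hT (hiff.1 h) hS

theorem isZero_rightDerived_one_of_epi_map [EnoughInjectives C] (G : C ⥤ D) [G.Additive]
    [PreservesFiniteLimits G] {S : ShortComplex C} (hS : S.ShortExact) [Injective S.X₂]
    (h : Epi (G.map S.g)) : IsZero ((G.rightDerived 1).obj S.X₁) := by
  obtain ⟨I, K, f, g, w, hT, _, hiff⟩ := exists_isZero_rightDerived_one_iff G S.X₁
  exact hiff.2 (epi_map_of_epi_map_of_injective G hS h hT)

/-- A right exact functor preserves short exactness of a sequence ending in an object at which its
first left derived functor vanishes. -/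
theorem shortExact_map_of_isZero_leftDerived_one [EnoughProjectives C] (F : C ⥤ D) [F.Additive]
    [PreservesFiniteColimits F] {S : ShortComplex C} (hS : S.ShortExact)
    (h : IsZero ((F.leftDerived 1).obj S.X₃)) : (S.map F).ShortExact := by
  have := hS.epi_g
  exact .mk' (hS.exact.map_of_epi_of_preservesCokernel F this inferInstance)
    (mono_map_of_isZero_leftDerived_one F hS h) (inferInstanceAs (Epi (F.map S.g)))

theorem shortExact_map_of_isZero_rightDerived_one [EnoughInjectives C] (G : C ⥤ D) [G.Additive]
    [PreservesFiniteLimits G] {S : ShortComplex C} (hS : S.ShortExact)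
    (h : IsZero ((G.rightDerived 1).obj S.X₁)) : (S.map G).ShortExact := by
  have := hS.mono_f
  exact .mk' (hS.exact.map_of_mono_of_preservesKernel G this inferInstance)
    (inferInstanceAs (Mono (G.map S.f))) (epi_map_of_isZero_rightDerived_one G hS h)

end DerivedFunctors

/-- The part of the snake lemma around the connecting morphism, for a monomorphism in the middle:
`c` is a monomorphism if and only if the induced morphism of the cokernels of `a` and `b` is. -/
theorem mono_iff_mono_of_ladder {C : Type u} [Category.{v} C] [Abelian C]
    {X₁ X₂ X₃ Y₁ Y₂ Y₃ Z₁ Z₂ : C} {f : X₁ ⟶ X₂} {g : X₂ ⟶ X₃} {f' : Y₁ ⟶ Y₂} {g' : Y₂ ⟶ Y₃}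
    {a : X₁ ⟶ Y₁} {b : X₂ ⟶ Y₂} {c : X₃ ⟶ Y₃} {p : Y₁ ⟶ Z₁} {q : Y₂ ⟶ Z₂} {h : Z₁ ⟶ Z₂}
    {w : f ≫ g = 0} {w' : f' ≫ g' = 0} {wp : a ≫ p = 0} {wq : b ≫ q = 0}
    (hX : (ShortComplex.mk f g w).Exact) (hY : (ShortComplex.mk f' g' w').Exact)
    (hp : (ShortComplex.mk a p wp).Exact) (hq : (ShortComplex.mk b q wq).Exact)
    (hab : f ≫ b = a ≫ f') (hbc : g ≫ c = b ≫ g') (hpq : p ≫ h = f' ≫ q)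
    [Epi g] [Mono f'] [Epi p] [Mono b] : Mono c ↔ Mono h := by
  constructor
  · intro _
    refine Preadditive.mono_of_cancel_zero _ fun {T} x hx => ?_
    obtain ⟨T₁, π₁, _, k, hk⟩ := surjective_up_to_refinements_of_epi p x
    obtain ⟨T₂, π₂, _, y, hy⟩ := hq.exact_up_to_refinements (k ≫ f')
      (by dsimp; rw [Category.assoc, ← hpq, ← reassoc_of% hk, hx, comp_zero])
    dsimp at y hy
    obtain ⟨T₃, π₃, _, z, hz⟩ := hX.exact_up_to_refinements y (by
      dsimp
      rw [← cancel_mono c, Category.assoc, hbc, ← reassoc_of% hy, w']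
      simp)
    dsimp at z hz
    have hz' : π₃ ≫ π₂ ≫ k = z ≫ a := by
      rw [← cancel_mono f']
      simp only [Category.assoc]
      rw [hy, reassoc_of% hz, hab]
    rw [← cancel_epi π₁, ← cancel_epi π₂, ← cancel_epi π₃, hk, reassoc_of% hz', wp]
    simp
  · intro _
    refine Preadditive.mono_of_cancel_zero _ fun {T} x hx => ?_
    obtain ⟨T₁, π₁, _, y, hy⟩ := surjective_up_to_refinements_of_epi g x
    obtain ⟨T₂, π₂, _, k, hk⟩ := hY.exact_up_to_refinements (y ≫ b)
      (by dsimp; rw [Category.assoc, ← hbc, ← reassoc_of% hy, hx, comp_zero])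
    dsimp at k hk
    obtain ⟨T₃, π₃, _, z, hz⟩ := hp.exact_up_to_refinements k (by
      dsimp
      rw [← cancel_mono h, Category.assoc, hpq, ← reassoc_of% hk, wq]
      simp)
    dsimp at z hz
    have hz' : π₃ ≫ π₂ ≫ y = z ≫ f := by
      rw [← cancel_mono b]
      simp only [Category.assoc]
      rw [hk, reassoc_of% hz, hab]
    rw [← cancel_epi π₁, ← cancel_epi π₂, ← cancel_epi π₃, hy, reassoc_of% hz', w]
    simp

/-! ### The counit of `j_! ⊣ j^*` and the unit of `i^* ⊣ i_*`. -/

namespace Recollement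

variable {A' : Type u₁} [Category.{v₁} A'] [Abelian A']
  {A : Type u₂} [Category.{v₂} A] [Abelian A]
  {A'' : Type u₃} [Category.{v₃} A''] [Abelian A'']
  (r : Recollement A' A A'')

instance : r.iPush.Full := r.iPush_full
instance : r.iPush.Faithful := r.iPush_faithful
instance : r.jShriek.Full := r.jShriek_full
instance : r.jShriek.Faithful := r.jShriek_faithful
instance : r.jPush.Full := r.jPush_full
instance : r.jPush.Faithful := r.jPush_faithful

instance : r.iPull.IsLeftAdjoint := r.iAdj.isLeftAdjoint
instance : r.iPush.IsRightAdjoint := r.iAdj.isRightAdjoint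
instance : r.iPush.IsLeftAdjoint := r.iAdj'.isLeftAdjoint
instance : r.iShriek.IsRightAdjoint := r.iAdj'.isRightAdjoint
instance : r.jShriek.IsLeftAdjoint := r.jAdj.isLeftAdjoint
instance : r.jPull.IsRightAdjoint := r.jAdj.isRightAdjoint
instance : r.jPull.IsLeftAdjoint := r.jAdj'.isLeftAdjoint
instance : r.jPush.IsRightAdjoint := r.jAdj'.isRightAdjoint


theorem isZero_jPull_iff (X : A) : IsZero (r.jPull.obj X) ↔ r.iPush.essImage X := by
  rw [← r.kernel_eq]
  rfl

theorem isZero_jPull_iPush (Y : A') : IsZero (r.jPull.obj (r.iPush.obj Y)) :=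
  (r.isZero_jPull_iff _).2 (r.iPush.obj_mem_essImage Y)

theorem isZero_iShriek_jPush (Z : A'') : IsZero (r.iShriek.obj (r.jPush.obj Z)) := by
  rw [IsZero.iff_id_eq_zero]
  apply (r.iAdj'.homEquiv _ _).symm.injective
  apply (r.jAdj'.homEquiv _ _).symm.injective
  exact (r.isZero_jPull_iPush _).eq_of_src _ _

theorem isZero_iPull_jShriek (Z : A'') : IsZero (r.iPull.obj (r.jShriek.obj Z)) := by
  rw [IsZero.iff_id_eq_zero]
  apply (r.iAdj.homEquiv _ _).injective
  apply (r.jAdj.homEquiv _ _).injective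
  exact (r.isZero_jPull_iPush _).eq_of_tgt _ _

theorem jShriek_iPush_hom_eq_zero {Z : A''} {Y : A'} (f : r.jShriek.obj Z ⟶ r.iPush.obj Y) :
    f = 0 :=
  (r.jAdj.homEquiv _ _).injective ((r.isZero_jPull_iPush _).eq_of_tgt _ _)

/-- The counit `j_! j^* X ⟶ X`. -/
def jCounit (X : A) : r.jShriek.obj (r.jPull.obj X) ⟶ X := r.jAdj.counit.app X

/-- The unit `X ⟶ i_* i^* X`. -/
def iUnit (X : A) : X ⟶ r.iPush.obj (r.iPull.obj X) := r.iAdj.unit.app X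

theorem jCounit_naturality {X Y : A} (f : X ⟶ Y) :
    r.jShriek.map (r.jPull.map f) ≫ r.jCounit Y = r.jCounit X ≫ f :=
  r.jAdj.counit_naturality f

theorem iUnit_naturality {X Y : A} (f : X ⟶ Y) :
    r.iUnit X ≫ r.iPush.map (r.iPull.map f) = f ≫ r.iUnit Y :=
  r.iAdj.unit_naturality f

instance (X : A) : IsIso (r.jPull.map (r.jCounit X)) :=
  inferInstanceAs (IsIso (r.jPull.map (r.jAdj.counit.app X)))

instance (X : A) : IsIso (r.iPull.map (r.iUnit X)) :=
  inferInstanceAs (IsIso (r.iPull.map (r.iAdj.unit.app X)))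

theorem jCounit_comp_iUnit (X : A) : r.jCounit X ≫ r.iUnit X = 0 :=
  r.jShriek_iPush_hom_eq_zero _

theorem isIso_iUnit_of_isZero {X : A} (hX : IsZero (r.jPull.obj X)) : IsIso (r.iUnit X) := by
  rw [r.isZero_jPull_iff] at hX
  exact (r.iAdj.isIso_unit_app_iff_mem_essImage).2 hX

theorem isZero_jPull_cokernel_jCounit (X : A) :
    IsZero (r.jPull.obj (cokernel (r.jCounit X))) :=
  (isZero_cokernel_of_epi (r.jPull.map (r.jCounit X))).of_iso (PreservesCokernel.iso r.jPull _)

theorem hom_ext_of_iUnit_comp {X : A} {Y : A'}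
    {f g : r.iPush.obj (r.iPull.obj X) ⟶ r.iPush.obj Y}
    (h : r.iUnit X ≫ f = r.iUnit X ≫ g) : f = g := by
  obtain ⟨f, rfl⟩ := r.iPush.map_surjective f
  obtain ⟨g, rfl⟩ := r.iPush.map_surjective g
  congr 1
  apply (r.iAdj.homEquiv _ _).injective
  simp only [Adjunction.homEquiv_unit]
  exact h

/-- The comparison of the cokernel of the counit `j_! j^* X ⟶ X` with `i_* i^* X`. -/
noncomputable def cokernelCounitIso (X : A) :
    cokernel (r.jCounit X) ≅ r.iPush.obj (r.iPull.obj X) :=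
  -- The cokernel is killed by `j^*`, hence lies in the image of `i_*`, where the unit is
  -- invertible.
  have := r.isIso_iUnit_of_isZero (r.isZero_jPull_cokernel_jCounit X)
  { hom := cokernel.desc _ (r.iUnit X) (r.jCounit_comp_iUnit X)
    inv := r.iPush.map (r.iPull.map (cokernel.π (r.jCounit X))) ≫
      inv (r.iUnit (cokernel (r.jCounit X)))
    hom_inv_id := by
      rw [← cancel_epi (cokernel.π _), cokernel.π_desc_assoc,
        reassoc_of% r.iUnit_naturality (cokernel.π (r.jCounit X))]
      simp
    inv_hom_id := by
      apply r.hom_ext_of_iUnit_comp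
      rw [Category.assoc, reassoc_of% r.iUnit_naturality (cokernel.π (r.jCounit X))]
      simp }

/-- No condition on `X` is needed here; (P) only bears on whether the counit is mono. -/
theorem exact_jCounit_iUnit (X : A) :
    (ShortComplex.mk _ _ (r.jCounit_comp_iUnit X)).Exact := by
  refine ShortComplex.exact_of_iso ?_ (ShortComplex.exact_cokernel (r.jCounit X))
  exact ShortComplex.isoMk (Iso.refl _) (Iso.refl _) (r.cokernelCounitIso X) (by simp)
    (by simp [cokernelCounitIso])

instance epi_iUnit (X : A) : Epi (r.iUnit X) := by
  have : cokernel.π (r.jCounit X) ≫ (r.cokernelCounitIso X).hom = r.iUnit X := by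
    simp [cokernelCounitIso]
  rw [← this]
  infer_instance

/-- The sequence `0 ⟶ j_! j^* X ⟶ X ⟶ i_* i^* X ⟶ 0` if the counit is a monomorphism. -/
theorem shortExact_jCounit_iUnit {X : A} (hX : Mono (r.jCounit X)) :
    (ShortComplex.mk _ _ (r.jCounit_comp_iUnit X)).ShortExact :=
  .mk' (r.exact_jCounit_iUnit X) hX (r.epi_iUnit X)

/-- The kernel is a quotient of `j_! j^* X`, while `i^*` preserves epimorphisms and kills `j_!`. -/
theorem isZero_iPull_kernel_iUnit (X : A) : IsZero (r.iPull.obj (kernel (r.iUnit X))) := by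
  have : Epi (kernel.lift (r.iUnit X) (r.jCounit X) (r.jCounit_comp_iUnit X)) :=
    (ShortComplex.exact_iff_epi_kernel_lift _).1 (r.exact_jCounit_iUnit X)
  exact IsZero.of_epi (r.iPull.map (kernel.lift (r.iUnit X) (r.jCounit X) _))
    (r.isZero_iPull_jShriek _)

/-- The snake lemma for the counits at the terms of `S`: their cokernels are `i_* i^*`, and `i_*`
preserves and reflects monomorphisms. -/
theorem mono_jCounit_iff {S : ShortComplex A} (hS : S.ShortExact) (h₂ : Mono (r.jCounit S.X₂)) :
    Mono (r.jCounit S.X₃) ↔ Mono (r.iPull.map S.f) := by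
  have := hS.epi_g
  have := hS.mono_f
  have hF : (ShortComplex.mk (r.jShriek.map (r.jPull.map S.f)) (r.jShriek.map (r.jPull.map S.g))
      (by simp [← Functor.map_comp])).Exact :=
    hS.exact.map_of_epi_of_preservesCokernel (r.jPull ⋙ r.jShriek) ‹_› inferInstance
  have h := mono_iff_mono_of_ladder hF hS.exact (r.exact_jCounit_iUnit S.X₁)
    (r.exact_jCounit_iUnit S.X₂) (r.jCounit_naturality S.f) (r.jCounit_naturality S.g)
    (r.iUnit_naturality S.f)
  exact h.trans ⟨fun h => r.iPush.mono_of_mono_map h, fun _ => inferInstance⟩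

/-- Under condition (P), `(L₁ i^*)(X)` vanishes if and only if the counit `j_! j^* X ⟶ X` is a
monomorphism. -/
theorem isZero_leftDerived_iPull_iff [EnoughProjectives A] (hP : r.ConditionP) (X : A) :
    IsZero ((r.iPull.leftDerived 1).obj X) ↔ Mono (r.jCounit X) := by
  have hS := shortExact_kernel (Projective.π X)
  refine Iff.trans ?_ (r.mono_jCounit_iff hS (hP _ inferInstance)).symm
  exact ⟨mono_map_of_isZero_leftDerived_one _ hS, isZero_leftDerived_one_of_mono_map _ hS⟩

theorem mono_jCounit_of_mono {X Y : A} (f : X ⟶ Y) [Mono f] [IsIso (r.jPull.map f)]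
    (hX : Mono (r.jCounit X)) : Mono (r.jCounit Y) := by
  have h : r.jCounit Y = r.jShriek.map (inv (r.jPull.map f)) ≫ r.jCounit X ≫ f := by
    rw [← r.jCounit_naturality, ← Functor.map_comp_assoc]
    simp
  rw [h]
  infer_instance

theorem mono_jCounit_of_mono_map {X Y : A} (f : X ⟶ Y)
    [Mono (r.jShriek.map (r.jPull.map f))] (hY : Mono (r.jCounit Y)) :
    Mono (r.jCounit X) :=
  mono_of_mono_fac (r.jCounit_naturality f).symm

theorem isIso_jPull_map_g {S : ShortComplex A} (hS : S.ShortExact)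
    (h : IsZero (r.jPull.obj S.X₁)) : IsIso (r.jPull.map S.g) :=
  (hS.map_of_exact r.jPull).isIso_g_iff.2 h

theorem isIso_jPull_map_f {S : ShortComplex A} (hS : S.ShortExact)
    (h : IsZero (r.jPull.obj S.X₃)) : IsIso (r.jPull.map S.f) :=
  (hS.map_of_exact r.jPull).isIso_f_iff.2 h

end Recollement

/-! ### Formal properties of cotorsion pairs. -/

section CotorsionPairs

variable {C : Type u} [Category.{v} C] [Abelian C] {U V : ObjectProperty C}

theorem IsCotorsionPair.ext1Vanishes (h : IsCotorsionPair U V) {X Y : C} (hX : U X) (hY : V Y) :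
    Ext1Vanishes X Y := by
  rw [← h.rightPerp_eq] at hY
  exact hY X hX

theorem IsCotorsionPair.left_of_retract (h : IsCotorsionPair U V) {X X' : C} (r : Retract X X')
    (hX : U X') : U X := by
  rw [← h.leftPerp_eq]
  exact fun Y hY => (h.ext1Vanishes hX hY).of_retract_left r

theorem IsCotorsionPair.left_of_iso (h : IsCotorsionPair U V) {X X' : C} (e : X ≅ X')
    (hX : U X) : U X' :=
  h.left_of_retract (Retract.ofIso e.symm) hX

theorem IsCotorsionPair.right_of_retract (h : IsCotorsionPair U V) {Y Y' : C} (r : Retract Y Y')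
    (hY : V Y') : V Y := by
  rw [← h.rightPerp_eq]
  exact fun X hX => (h.ext1Vanishes hX hY).of_retract_right r

theorem IsCotorsionPair.right_of_iso (h : IsCotorsionPair U V) {Y Y' : C} (e : Y ≅ Y')
    (hY : V Y) : V Y' :=
  h.right_of_retract (Retract.ofIso e.symm) hY

theorem IsCotorsionPair.right_of_shortExact (h : IsCotorsionPair U V) {S : ShortComplex C}
    (hS : S.ShortExact) (h₁ : V S.X₁) (h₃ : V S.X₃) : V S.X₂ := by
  rw [← h.rightPerp_eq]
  exact fun X hX => ext1Vanishes_middle_right hS (h.ext1Vanishes hX h₁) (h.ext1Vanishes hX h₃)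

theorem IsCotorsionPair.right_of_injective (h : IsCotorsionPair U V) (I : C) [Injective I] :
    V I := by
  rw [← h.rightPerp_eq]
  exact fun X _ => ext1Vanishes_of_injective X I

theorem IsCotorsionPair.right_of_isZero (h : IsCotorsionPair U V) {Y : C} (hY : IsZero Y) : V Y :=
  have := hY.injective
  h.right_of_injective Y

theorem IsCotorsionPair.left_of_projective (h : IsCotorsionPair U V) (P : C) [Projective P] :
    U P := by
  rw [← h.leftPerp_eq]
  exact fun Y _ => ext1Vanishes_of_projective P Y

/-- A criterion for complete hereditary cotorsion pairs in terms of left approximations and of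
closure properties. -/
theorem isCompleteHereditaryCotorsionPair_of_exists_left [EnoughProjectives C]
    [EnoughInjectives C] (hUV : ∀ X Y : C, U X → V Y → Ext1Vanishes X Y)
    (hU : ∀ {X X' : C}, Retract X X' → U X' → U X)
    (hV : ∀ {Y Y' : C}, Retract Y Y' → V Y' → V Y)
    (hV_ext : ∀ S : ShortComplex C, S.ShortExact → V S.X₁ → V S.X₃ → V S.X₂)
    (hV_inj : ∀ I : C, Injective I → V I)
    (hU_ker : ∀ S : ShortComplex C, S.ShortExact → U S.X₂ → U S.X₃ → U S.X₁)
    (hleft : ∀ M : C, ∃ (V₁ U₁ : C) (f : V₁ ⟶ U₁) (g : U₁ ⟶ M) (w : f ≫ g = 0),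
      (ShortComplex.mk f g w).ShortExact ∧ U U₁ ∧ V V₁) :
    IsCompleteHereditaryCotorsionPair U V := by
  have hright : ∀ M : C, ∃ (V₂ U₂ : C) (f : M ⟶ V₂) (g : V₂ ⟶ U₂) (w : f ≫ g = 0),
      (ShortComplex.mk f g w).ShortExact ∧ U U₂ ∧ V V₂ := by
    intro M
    -- Salce's trick: pulling back a left approximation of the cosyzygy gives a middle term that is
    -- an extension of an injective by `V₁`.
    obtain ⟨V₁, U₁, f, g, w, hS, hU₁, hV₁⟩ := hleft (cokernel (Injective.ι M))
    have sq := IsPullback.of_hasPullback (cokernel.π (Injective.ι M)) g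
    exact ⟨_, _, _, _, _, shortExact_of_isPullback (shortExact_cokernel (Injective.ι M)) sq, hU₁,
      hV_ext _ (shortExact_of_isPullback hS sq.flip) hV₁ (hV_inj _ inferInstance)⟩
  have hr : rightPerp U = V := by
    ext Y
    refine ⟨fun hY => ?_, fun hY X hX => hUV X Y hX hY⟩
    obtain ⟨V₂, U₂, f, g, w, hS, hU₂, hV₂⟩ := hright Y
    obtain ⟨t, ht⟩ := (hY _ hU₂).exists_extension hS (𝟙 Y)
    exact hV ⟨f, t, ht⟩ hV₂
  have hl : leftPerp V = U := by
    ext X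
    refine ⟨fun hX => ?_, fun hX Y hY => hUV X Y hX hY⟩
    obtain ⟨V₁, U₁, f, g, w, hS, hU₁, hV₁⟩ := hleft X
    obtain ⟨t, ht⟩ := (hX _ hV₁).exists_lift hS (𝟙 X)
    exact hU ⟨t, g, ht⟩ hU₁
  have h : IsCotorsionPair U V := ⟨hr, hl⟩
  refine { h with
    exists_left := hleft, exists_right := hright, kernel_mem := hU_ker, cokernel_mem := ?_ }
  intro S hS h₁ h₂
  rw [← hr]
  intro X hX
  -- The syzygy of `X` lies in `U`, so a map from it to `S.X₃` lifts to `S.X₂`, and the lift extends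
  -- to the projective; no `Ext²` is needed.
  have hT := shortExact_kernel (Projective.π X)
  refine ext1Vanishes_of_exists_extension hT fun x => ?_
  obtain ⟨y, rfl⟩ := (hUV _ _ (hU_ker _ hT (h.left_of_projective _) hX) h₁).exists_lift hS x
  obtain ⟨z, rfl⟩ := (hUV _ _ hX h₂).exists_extension hT y
  exact ⟨z ≫ S.g, by simp⟩

end CotorsionPairs

section DerivedFunctors

variable {C : Type u₁} [Category.{v₁} C] [Abelian C] {D : Type u₂} [Category.{v₂} D] [Abelian D]

/-- The vanishing of the first right derived functor of a left exact functor is closed under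
extensions. -/
theorem isZero_rightDerived_one_of_shortExact [EnoughInjectives C] (G : C ⥤ D) [G.Additive]
    [PreservesFiniteLimits G] {S : ShortComplex C} (hS : S.ShortExact)
    (h₁ : IsZero ((G.rightDerived 1).obj S.X₁)) (h₃ : IsZero ((G.rightDerived 1).obj S.X₃)) :
    IsZero ((G.rightDerived 1).obj S.X₂) := by
  have := hS.epi_g
  have := hS.mono_f
  have hT := shortExact_cokernel (Injective.ι S.X₂)
  have sq := IsPushout.of_hasPushout (Injective.ι S.X₂) S.g
  have hT' := shortExact_of_isPushout hT sq
  -- With `I` the injective hull term, the pushout is `I / X₁`, and `I ⟶ I / X₂` factors as `I ⟶ I /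
  -- X₁ ⟶ I / X₂` with kernels `X₁` and `X₃`; `G` keeps both factors epi.
  have hQ : (ShortComplex.mk (S.f ≫ Injective.ι S.X₂) (pushout.inl (Injective.ι S.X₂) S.g)
      (by rw [Category.assoc, sq.w, S.zero_assoc, zero_comp])).ShortExact := by
    refine .mk' ?_ (mono_comp _ _) inferInstance
    rw [ShortComplex.exact_iff_exact_up_to_refinements]
    intro T x hx
    dsimp at x hx
    have hx' : x ≫ cokernel.π (Injective.ι S.X₂) = 0 := by
      have := hx =≫ sq.desc (cokernel.π (Injective.ι S.X₂)) 0 (by simp)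
      simpa using this
    obtain ⟨T₁, π₁, _, y, hy⟩ := hT.exact.exact_up_to_refinements x hx'
    dsimp at y hy
    obtain ⟨T₂, π₂, _, z, hz⟩ := hS.exact.exact_up_to_refinements y (by
      rw [← cancel_mono (pushout.inr (Injective.ι S.X₂) S.g), Category.assoc, ← sq.w,
        ← reassoc_of% hy, hx]
      simp)
    refine ⟨T₂, π₂ ≫ π₁, epi_comp _ _, z, ?_⟩
    dsimp
    rw [Category.assoc, hy, reassoc_of% hz]
  refine isZero_rightDerived_one_of_epi_map G hT ?_
  have e₁ := epi_map_of_isZero_rightDerived_one G hQ h₁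
  have e₂ := epi_map_of_isZero_rightDerived_one G hT' h₃
  dsimp at e₁ e₂ ⊢
  rw [← sq.inl_desc (cokernel.π (Injective.ι S.X₂)) 0 (by simp), G.map_comp]
  exact epi_comp _ _

end DerivedFunctors

theorem exists_section_of_adjunction {C : Type u₁} [Category.{v₁} C] {D : Type u₂}
    [Category.{v₂} D] {L : C ⥤ D} {R : D ⥤ C} (adj : L ⊣ R) {U : C} {E : D}
    (g : E ⟶ L.obj U) (t : U ⟶ R.obj E) (ht : t ≫ R.map g = adj.unit.app U) :
    ∃ s : L.obj U ⟶ E, s ≫ g = 𝟙 _ := by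
  refine ⟨(adj.homEquiv _ _).symm t, ?_⟩
  rw [← adj.homEquiv_naturality_right_symm, Equiv.symm_apply_eq, ht, adj.homEquiv_id]

/-! ### `Ext¹` and `R₁ i^!` across the recollement. -/

namespace Recollement

variable {A' : Type u₁} [Category.{v₁} A'] [Abelian A']
  {A : Type u₂} [Category.{v₂} A] [Abelian A]
  {A'' : Type u₃} [Category.{v₃} A''] [Abelian A'']
  (r : Recollement A' A A'')

/-- Since `j^*` is exact, the unit at `Z` lifts through `j^*` of any extension, and its transpose is
a section. -/
theorem ext1Vanishes_jShriek [EnoughProjectives A] {Z : A''} {Y : A}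
    (h : Ext1Vanishes Z (r.jPull.obj Y)) : Ext1Vanishes (r.jShriek.obj Z) Y := by
  refine ext1Vanishes_of_forall_split fun E f g w hS => ?_
  obtain ⟨t, ht⟩ := Ext1Vanishes.exists_lift (hS.map_of_exact r.jPull) h (r.jAdj.unit.app Z)
  exact exists_section_of_adjunction r.jAdj g t ht

theorem ext1Vanishes_iPush [EnoughProjectives A] [EnoughInjectives A] {Z : A'} {Y : A}
    (hY : IsZero ((r.iShriek.rightDerived 1).obj Y))
    (h : Ext1Vanishes Z (r.iShriek.obj Y)) : Ext1Vanishes (r.iPush.obj Z) Y := by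
  refine ext1Vanishes_of_forall_split fun E f g w hS => ?_
  obtain ⟨t, ht⟩ := Ext1Vanishes.exists_lift
    (shortExact_map_of_isZero_rightDerived_one r.iShriek hS hY) h (r.iAdj'.unit.app Z)
  exact exists_section_of_adjunction r.iAdj' g t ht

/-- For an extension `f : j^* I ⟶ E` of `Z`, `j_! f` is mono. The counit at `I` therefore extends
along it, and the transpose of the extension retracts `f`. -/
theorem ext1Vanishes_jPull_of_injective [EnoughProjectives A''] {Z : A''} (I : A) [Injective I]
    (hZ : IsZero ((r.jShriek.leftDerived 1).obj Z)) : Ext1Vanishes Z (r.jPull.obj I) := by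
  refine ext1Vanishes_of_forall_split fun E f g w hS => ?_
  have : Mono (r.jShriek.map f) := mono_map_of_isZero_leftDerived_one r.jShriek hS hZ
  let t : r.jShriek.obj E ⟶ I := Injective.factorThru (r.jCounit I) (r.jShriek.map f)
  have ht : f ≫ r.jAdj.homEquiv _ _ t = 𝟙 _ := by
    rw [← r.jAdj.homEquiv_naturality_left, Injective.comp_factorThru, ← Equiv.eq_symm_apply,
      r.jAdj.homEquiv_symm_id]
    rfl
  have := hS.epi_g
  let σ := ShortComplex.Splitting.ofExactOfRetraction _ hS.exact _ ht hS.epi_g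
  exact ⟨σ.s, σ.s_g⟩

theorem isZero_jPull_of_shortExact {S : ShortComplex A} (hS : S.ShortExact)
    (h₁ : IsZero (r.jPull.obj S.X₁)) (h₃ : IsZero (r.jPull.obj S.X₃)) :
    IsZero (r.jPull.obj S.X₂) := by
  have := r.isIso_jPull_map_g hS h₁
  exact h₃.of_iso (asIso (r.jPull.map S.g))

theorem epi_iShriek_map_of_isZero {X : A} {Y : A'} (hX : IsZero (r.jPull.obj X))
    (f : X ⟶ r.iPush.obj Y) [Epi f] : Epi (r.iShriek.map f) := by
  obtain ⟨Z, ⟨e⟩⟩ := (r.isZero_jPull_iff X).1 hX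
  obtain ⟨g, hg⟩ := r.iPush.map_surjective (e.hom ≫ f)
  have : Epi (r.iPush.map g) := by rw [hg]; infer_instance
  have : Epi g := r.iPush.epi_of_epi_map this
  have hu := r.iAdj'.unit_naturality g
  rw [hg, Functor.map_comp] at hu
  have : Epi (r.iAdj'.unit.app Z ≫ r.iShriek.map e.hom ≫ r.iShriek.map f) := by
    rw [hu]
    exact epi_comp _ _
  exact epi_of_epi_fac (Category.assoc (r.iAdj'.unit.app Z) (r.iShriek.map e.hom) (r.iShriek.map f))

/-- Pull an injective presentation back along the counit `i_* i^! K ⟶ K`, which `i^!` inverts. The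
result is a sequence in the image of `i_*`, where `i^!` preserves epimorphisms. -/
theorem isZero_rightDerived_iShriek_iPush [EnoughInjectives A] (Y : A') :
    IsZero ((r.iShriek.rightDerived 1).obj (r.iPush.obj Y)) := by
  have hS := shortExact_cokernel (Injective.ι (r.iPush.obj Y))
  refine isZero_rightDerived_one_of_epi_map r.iShriek hS ?_
  dsimp
  set K := cokernel (Injective.ι (r.iPush.obj Y))
  let c : r.iPush.obj (r.iShriek.obj K) ⟶ K := r.iAdj'.counit.app K
  have : IsIso (r.iShriek.map c) :=
    inferInstanceAs (IsIso (r.iShriek.map (r.iAdj'.counit.app K)))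
  have sq := IsPullback.of_hasPullback (cokernel.π (Injective.ι (r.iPush.obj Y))) c
  have hT := shortExact_of_isPullback hS sq
  have := hT.epi_g
  have h := r.isZero_jPull_of_shortExact hT (r.isZero_jPull_iPush _) (r.isZero_jPull_iPush _)
  have := r.epi_iShriek_map_of_isZero h
    (pullback.snd (cokernel.π (Injective.ι (r.iPush.obj Y))) c)
  have w := r.iShriek.congr_map sq.w
  rw [Functor.map_comp, Functor.map_comp] at w
  exact epi_of_epi_fac w

/-- `j_*` carries an injective presentation of `Z` to one of `j_* Z`, and `i^! j_* = 0`. -/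
theorem isZero_rightDerived_iShriek_jPush [EnoughInjectives A] [EnoughInjectives A''] {Z : A''}
    (hZ : IsZero ((r.jPush.rightDerived 1).obj Z)) :
    IsZero ((r.iShriek.rightDerived 1).obj (r.jPush.obj Z)) := by
  have hS := shortExact_cokernel (Injective.ι Z)
  have hT := shortExact_map_of_isZero_rightDerived_one r.jPush hS hZ
  have : Injective ((ShortComplex.mk _ _ (cokernel.condition (Injective.ι Z))).map r.jPush).X₂ :=
    r.jAdj'.map_injective _ inferInstance
  exact isZero_rightDerived_one_of_epi_map r.iShriek hT
    ⟨fun _ _ _ => (r.isZero_iShriek_jPush _).eq_of_src _ _⟩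

end Recollement

/-! ### The classes `ℳ` and `𝒩`, and the left approximations. -/

namespace Recollement

variable {A' : Type u₁} [Category.{v₁} A'] [Abelian A']
  {A : Type u₂} [Category.{v₂} A] [Abelian A]
  {A'' : Type u₃} [Category.{v₃} A''] [Abelian A'']
  (r : Recollement A' A A'')

section Approximation

variable {U' V' : ObjectProperty A'} {U'' V'' : ObjectProperty A''}

theorem classM_of_retract [EnoughProjectives A] (h' : IsCotorsionPair U' V')
    (h'' : IsCotorsionPair U'' V'') {X X' : A} (e : Retract X X') (hX : r.classM U' U'' X') :
    r.classM U' U'' X :=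
  ⟨h'.left_of_retract (e.map _) hX.1, h''.left_of_retract (e.map _) hX.2.1,
    hX.2.2.of_mono (e.map (r.iPull.leftDerived 1)).i⟩

theorem classN_of_retract [EnoughInjectives A] (h' : IsCotorsionPair U' V')
    (h'' : IsCotorsionPair U'' V'') {Y Y' : A} (e : Retract Y Y') (hY : r.classN V' V'' Y') :
    r.classN V' V'' Y :=
  ⟨h'.right_of_retract (e.map _) hY.1, h''.right_of_retract (e.map _) hY.2.1,
    hY.2.2.of_mono (e.map (r.iShriek.rightDerived 1)).i⟩

theorem classN_of_iso [EnoughInjectives A] (h' : IsCotorsionPair U' V')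
    (h'' : IsCotorsionPair U'' V'') {Y Y' : A} (e : Y ≅ Y') (hY : r.classN V' V'' Y) :
    r.classN V' V'' Y' :=
  r.classN_of_retract h' h'' (Retract.ofIso e.symm) hY

theorem classN_of_shortExact [EnoughInjectives A] (h' : IsCotorsionPair U' V')
    (h'' : IsCotorsionPair U'' V'') {S : ShortComplex A} (hS : S.ShortExact)
    (h₁ : r.classN V' V'' S.X₁) (h₃ : r.classN V' V'' S.X₃) : r.classN V' V'' S.X₂ :=
  ⟨h'.right_of_shortExact (shortExact_map_of_isZero_rightDerived_one r.iShriek hS h₁.2.2) h₁.1 h₃.1,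
    h''.right_of_shortExact (hS.map_of_exact r.jPull) h₁.2.1 h₃.2.1,
    isZero_rightDerived_one_of_shortExact r.iShriek hS h₁.2.2 h₃.2.2⟩

theorem classN_of_injective [EnoughInjectives A] [EnoughProjectives A'']
    (h' : IsCotorsionPair U' V') (h'' : IsCotorsionPair U'' V'')
    (hL : ∀ X : A'', U'' X → IsZero ((r.jShriek.leftDerived 1).obj X)) (I : A) [Injective I] :
    r.classN V' V'' I := by
  have : Injective (r.iShriek.obj I) := r.iAdj'.map_injective _ inferInstance
  refine ⟨h'.right_of_injective _, ?_, r.iShriek.isZero_rightDerived_obj_injective_succ 0 I⟩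
  rw [← h''.rightPerp_eq]
  exact fun Z hZ => r.ext1Vanishes_jPull_of_injective I (hL Z hZ)

theorem classN_iPush [EnoughInjectives A] (h' : IsCotorsionPair U' V')
    (h'' : IsCotorsionPair U'' V'') {Y : A'} (hY : V' Y) : r.classN V' V'' (r.iPush.obj Y) :=
  ⟨h'.right_of_iso (asIso (r.iAdj'.unit.app Y)) hY,
    h''.right_of_isZero (r.isZero_jPull_iPush Y), r.isZero_rightDerived_iShriek_iPush Y⟩

theorem classN_jPush [EnoughInjectives A] [EnoughInjectives A''] (h' : IsCotorsionPair U' V')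
    (h'' : IsCotorsionPair U'' V'') {Z : A''} (hZ : V'' Z)
    (hR : IsZero ((r.jPush.rightDerived 1).obj Z)) : r.classN V' V'' (r.jPush.obj Z) :=
  ⟨h'.right_of_isZero (r.isZero_iShriek_jPush Z),
    h''.right_of_iso (asIso (r.jAdj'.counit.app Z)).symm hZ,
    r.isZero_rightDerived_iShriek_jPush hR⟩

theorem ext1Vanishes_of_classM_of_classN [EnoughProjectives A] [EnoughInjectives A]
    (hP : r.ConditionP) (h' : IsCotorsionPair U' V') (h'' : IsCotorsionPair U'' V'') {X Y : A}
    (hX : r.classM U' U'' X) (hY : r.classN V' V'' Y) : Ext1Vanishes X Y :=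
  ext1Vanishes_middle_left
    (r.shortExact_jCounit_iUnit ((r.isZero_leftDerived_iPull_iff hP X).1 hX.2.2))
    (r.ext1Vanishes_jShriek (h''.ext1Vanishes hX.2.1 hY.2.1))
    (r.ext1Vanishes_iPush hY.2.2 (h'.ext1Vanishes hX.1 hY.1))

/-- Vanishing of `L₁ j_!` at `j^* X₃` makes `j_! j^* X₁ ⟶ j_! j^* X₂` mono, so the mono counit at
`X₂` forces one at `X₁`. -/
theorem classM_kernel [EnoughProjectives A] [EnoughProjectives A''] (hP : r.ConditionP)
    (h' : IsCompleteHereditaryCotorsionPair U' V')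
    (h'' : IsCompleteHereditaryCotorsionPair U'' V'')
    (hL : ∀ X : A'', U'' X → IsZero ((r.jShriek.leftDerived 1).obj X))
    {S : ShortComplex A} (hS : S.ShortExact) (h₂ : r.classM U' U'' S.X₂)
    (h₃ : r.classM U' U'' S.X₃) : r.classM U' U'' S.X₁ := by
  have hj := hS.map_of_exact r.jPull
  refine ⟨h'.kernel_mem _ (shortExact_map_of_isZero_leftDerived_one r.iPull hS h₃.2.2) h₂.1 h₃.1,
    h''.kernel_mem _ hj h₂.2.1 h₃.2.1, (r.isZero_leftDerived_iPull_iff hP _).2 ?_⟩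
  have : Mono (r.jShriek.map (r.jPull.map S.f)) :=
    mono_map_of_isZero_leftDerived_one r.jShriek hj (hL _ h₃.2.1)
  exact r.mono_jCounit_of_mono_map S.f ((r.isZero_leftDerived_iPull_iff hP _).1 h₂.2.2)

theorem isIso_iPull_map_g {S : ShortComplex A} (hS : S.ShortExact)
    (h : IsZero (r.iPull.obj S.X₁)) : IsIso (r.iPull.map S.g) := by
  have := hS.epi_g
  have hF := hS.exact.map_of_epi_of_preservesCokernel r.iPull ‹_› inferInstance
  have : Mono (r.iPull.map S.g) := hF.mono_g (h.eq_of_src _ _)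
  exact isIso_of_mono_of_epi _

/-- Every object is the target of an epimorphism with kernel in `𝒩` from an object `Y` with
`j^* Y ∈ 𝒰''`. -/
theorem exists_epi_jPull_mem [EnoughInjectives A] [EnoughInjectives A'']
    (h' : IsCompleteHereditaryCotorsionPair U' V')
    (h'' : IsCompleteHereditaryCotorsionPair U'' V'')
    (hR : ∀ Y : A'', V'' Y → IsZero ((r.jPush.rightDerived 1).obj Y)) (M : A) :
    ∃ (Y : A) (q : Y ⟶ M), Epi q ∧ r.classN V' V'' (kernel q) ∧ U'' (r.jPull.obj Y) := by
  obtain ⟨Z, W, f, g, w, hS, hW, hZ⟩ := h''.exists_left (r.jPull.obj M)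
  let η : M ⟶ r.jPush.obj (r.jPull.obj M) := r.jAdj'.unit.app M
  have : IsIso (r.jPull.map η) :=
    inferInstanceAs (IsIso (r.jPull.map (r.jAdj'.unit.app M)))
  -- `j^*` inverts `η`, so it sends this pullback to `j^* j_* W ≅ W`, while the kernel over `M` is
  -- `j_* Z`.
  have sq := IsPullback.of_hasPullback (r.jPush.map g) η
  have hT := shortExact_of_isPullback
    (shortExact_map_of_isZero_rightDerived_one r.jPush hS (hR Z hZ)) sq
  refine ⟨_, pullback.snd (r.jPush.map g) η, hT.epi_g, ?_, ?_⟩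
  · exact r.classN_of_iso h'.1 h''.1 (hT.fIsKernel.conePointUniqueUpToIso (limit.isLimit _))
      (r.classN_jPush h'.1 h''.1 hZ (hR Z hZ))
  · have := (sq.map r.jPull).isIso_fst_of_isIso
    exact h''.left_of_iso
      (asIso (r.jPull.map (pullback.fst (r.jPush.map g) η)) ≪≫ asIso (r.jAdj'.counit.app W)).symm
      hW

theorem mono_jCounit_biprod {X : A} (hX : Mono (r.jCounit X)) (Y : A') :
    Mono (r.jCounit (X ⊞ r.iPush.obj Y)) := by
  have hS := (ShortComplex.Splitting.ofHasBinaryBiproduct X (r.iPush.obj Y)).shortExact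
  have : IsIso (r.jPull.map (biprod.inl : X ⟶ X ⊞ r.iPush.obj Y)) :=
    r.isIso_jPull_map_f hS (r.isZero_jPull_iPush Y)
  exact r.mono_jCounit_of_mono (biprod.inl : X ⟶ X ⊞ r.iPush.obj Y) hX

theorem mono_iPull_map_iPush_map {X Y : A'} (f : X ⟶ Y) [Mono f] :
    Mono (r.iPull.map (r.iPush.map f)) := by
  have : Mono (r.iAdj.counit.app X ≫ f) := mono_comp _ _
  exact mono_of_mono_fac (r.iAdj.counit_naturality f)

/-- Every object `Y` is the target of an epimorphism with kernel in `i_* 𝒱'` from an object at which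
the counit of `j_! ⊣ j^*` is a monomorphism. -/
theorem exists_epi_mono_jCounit [EnoughProjectives A] [EnoughInjectives A] (hP : r.ConditionP)
    (h' : IsCompleteHereditaryCotorsionPair U' V') (h'' : IsCotorsionPair U'' V'') (Y : A) :
    ∃ (X : A) (q : X ⟶ Y), Epi q ∧ r.classN V' V'' (kernel q) ∧ IsIso (r.jPull.map q) ∧
      Mono (r.jCounit X) := by
  obtain ⟨K, P, k, p, wk, hS, _⟩ : ∃ (K P : A) (k : K ⟶ P) (p : P ⟶ Y) (wk : k ≫ p = 0),
      (ShortComplex.mk k p wk).ShortExact ∧ Projective P :=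
    ⟨_, _, _, _, _, shortExact_kernel (Projective.π Y), inferInstance⟩
  have : Mono k := hS.mono_f
  obtain ⟨Z, W, f, g, w, hZW, hW, hZ⟩ := h'.exists_right (r.iPull.obj K)
  have : Mono f := hZW.mono_f
  -- Pushing out along the unit alone would already make the counit mono; embedding `i^* K` into `Z`
  -- puts the new kernel into `i_* 𝒱'`.
  let a : K ⟶ r.iPush.obj Z := r.iUnit K ≫ r.iPush.map f
  have sq := IsPushout.of_hasPushout k a
  have hT := shortExact_of_isPushout hS sq
  refine ⟨_, _, hT.epi_g, ?_, r.isIso_jPull_map_g hT (r.isZero_jPull_iPush Z), ?_⟩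
  · exact r.classN_of_iso h'.1 h'' (hT.fIsKernel.conePointUniqueUpToIso (limit.isLimit _))
      (r.classN_iPush h'.1 h'' hZ)
  -- The pushout is the cokernel of `K ⟶ P ⊞ i_* Z`. The component of this map in `i_* Z` is `-a`,
  -- and `i^* a` is mono.
  · refine (r.mono_jCounit_iff (shortExact_biprod_of_isPushout sq)
      (r.mono_jCounit_biprod (hP _ inferInstance) Z)).2 ?_
    have := r.mono_iPull_map_iPush_map f
    have hs : r.iPull.map (biprod.lift k (-a)) ≫ r.iPull.map (-biprod.snd) =
        r.iPull.map (r.iUnit K) ≫ r.iPull.map (r.iPush.map f) := by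
      rw [← Functor.map_comp, ← Functor.map_comp]
      simp [a]
    exact mono_of_mono_fac hs

/-- Pull back `i_* W ⟶ i_* i^* Y` along the unit. The kernel over `Y` is in `i_* 𝒱'`, so `j^*` does
not change; the kernel over `i_* W` is that of the unit, which `i^*` kills, so `i^* X ≅ W`. -/
theorem exists_epi_classM [EnoughProjectives A] [EnoughInjectives A] (hP : r.ConditionP)
    (h' : IsCompleteHereditaryCotorsionPair U' V') (h'' : IsCotorsionPair U'' V'') {Y : A}
    (hY : Mono (r.jCounit Y)) (hY'' : U'' (r.jPull.obj Y)) :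
    ∃ (X : A) (q : X ⟶ Y), Epi q ∧ r.classN V' V'' (kernel q) ∧ r.classM U' U'' X := by
  obtain ⟨Z, W, f, g, w, hS, hW, hZ⟩ := h'.exists_left (r.iPull.obj Y)
  have sq := IsPullback.of_hasPullback (r.iPush.map g) (r.iUnit Y)
  have hT := shortExact_of_isPullback (hS.map_of_exact r.iPush) sq
  have hQ := shortExact_of_isPullback (shortExact_kernel (r.iUnit Y)) sq.flip
  have : IsIso (r.jPull.map (pullback.snd (r.iPush.map g) (r.iUnit Y))) :=
    r.isIso_jPull_map_g hT (r.isZero_jPull_iPush Z)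
  have : IsIso (r.iPull.map (pullback.fst (r.iPush.map g) (r.iUnit Y))) :=
    r.isIso_iPull_map_g hQ (r.isZero_iPull_kernel_iUnit Y)
  refine ⟨_, pullback.snd (r.iPush.map g) (r.iUnit Y), hT.epi_g, ?_, ?_, ?_, ?_⟩
  · exact r.classN_of_iso h'.1 h'' (hT.fIsKernel.conePointUniqueUpToIso (limit.isLimit _))
      (r.classN_iPush h'.1 h'' hZ)
  · exact h'.left_of_iso (asIso (r.iPull.map (pullback.fst (r.iPush.map g) (r.iUnit Y))) ≪≫
      asIso (r.iAdj.counit.app W)).symm hW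
  · exact h''.left_of_iso
      (asIso (r.jPull.map (pullback.snd (r.iPush.map g) (r.iUnit Y)))).symm hY''
  · exact (r.isZero_leftDerived_iPull_iff hP _).2
      (r.mono_jCounit_of_mono_map (pullback.snd (r.iPush.map g) (r.iUnit Y)) hY)

theorem exists_left_approximation [EnoughProjectives A] [EnoughInjectives A]
    [EnoughInjectives A''] (hP : r.ConditionP) (h' : IsCompleteHereditaryCotorsionPair U' V')
    (h'' : IsCompleteHereditaryCotorsionPair U'' V'')
    (hR : ∀ Y : A'', V'' Y → IsZero ((r.jPush.rightDerived 1).obj Y)) (M : A) :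
    ∃ (X : A) (q : X ⟶ M), Epi q ∧ r.classN V' V'' (kernel q) ∧ r.classM U' U'' X := by
  obtain ⟨Y₁, q₁, _, hq₁, hY₁⟩ := r.exists_epi_jPull_mem h' h'' hR M
  obtain ⟨Y₂, q₂, _, hq₂, _, hY₂⟩ := r.exists_epi_mono_jCounit hP h' h''.1 Y₁
  obtain ⟨X, q₃, _, hq₃, hX⟩ := r.exists_epi_classM hP h' h''.1 hY₂
    (h''.left_of_iso (asIso (r.jPull.map q₂)).symm hY₁)
  exact ⟨X, q₃ ≫ q₂ ≫ q₁, inferInstance,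
    r.classN_of_shortExact h'.1 h''.1 (shortExact_kernel_comp q₃ (q₂ ≫ q₁)) hq₃
      (r.classN_of_shortExact h'.1 h''.1 (shortExact_kernel_comp q₂ q₁) hq₂ hq₁), hX⟩

end Approximation

end Recollement

end RecollementGluing

theorem theorem3p12
    {A' : Type u₁} [Category.{v₁} A'] [Abelian A'] [EnoughProjectives A'] [EnoughInjectives A']
    {A : Type u₂} [Category.{v₂} A] [Abelian A] [EnoughProjectives A] [EnoughInjectives A]
    {A'' : Type u₃} [Category.{v₃} A''] [Abelian A''] [EnoughProjectives A'']
    [EnoughInjectives A'']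
    (r : RecollementGluing.Recollement A' A A'') (hP : r.ConditionP)
    (U' V' : ObjectProperty A') (U'' V'' : ObjectProperty A'')
    (h' : RecollementGluing.IsCompleteHereditaryCotorsionPair U' V')
    (h'' : RecollementGluing.IsCompleteHereditaryCotorsionPair U'' V'')
    (hL : ∀ X : A'', U'' X → IsZero ((r.jShriek.leftDerived 1).obj X))
    (hR : ∀ Y : A'', V'' Y → IsZero ((r.jPush.rightDerived 1).obj Y)) :
    RecollementGluing.IsCompleteHereditaryCotorsionPair (r.classM U' U'') (r.classN V' V'') := by
  refine RecollementGluing.isCompleteHereditaryCotorsionPair_of_exists_left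
    (fun _ _ => r.ext1Vanishes_of_classM_of_classN hP h'.1 h''.1)
    (r.classM_of_retract h'.1 h''.1) (r.classN_of_retract h'.1 h''.1)
    (fun _ => r.classN_of_shortExact h'.1 h''.1)
    (fun I _ => r.classN_of_injective h'.1 h''.1 hL I)
    (fun _ => r.classM_kernel hP h' h'' hL) fun M => ?_
  obtain ⟨X, q, _, hq, hX⟩ := r.exists_left_approximation hP h' h'' hR M
  exact ⟨_, X, _, q, _, RecollementGluing.shortExact_kernel q, hX, hq⟩
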